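/- Let $k$ be a field, let $m\ge 6$ and $n=3m$, and let $S=k[a_i,b_i,c_i : i\in\mathbb Z/m]$ be the polynomial ring in $n$ variables with its standard grading. Let $P$ be the $S$-module of $k$-linear functionals on $S$ that vanish on $(S_+)^N$ for some $N$, with $(s\cdot f)(t)=f(st)$ (contraction). It has as a basis the divided power monomials $\mathbf x^{[\mathbf e]}$ dual to the monomials $\mathbf x^{\mathbf e}$ of $S$. For $f\in P$ put $\mathrm{Ann}(f)=\{s\in S : s\cdot f=0\}$ and $\mathrm{Apolar}(f)=S/\mathrm{Ann}(f)$; write $H(M)_d=\dim_k M_d$ for a graded module $M$. For $f\in P$ homogeneous of degree $3$, $\mathrm{Apolar}(f)$ satisfies the *small tangent space condition* if $\mathrm{Apolar}(f)$ has Hilbert function $(1,n,n,1)$ (zero in degrees $\ge 4$) and $H(S/\mathrm{Ann}(f)^2)_4=n$, $H(S/\mathrm{Ann}(f)^2)_5=0$. Let $$F=\sum_{i\in\mathbb Z/m} \left(a_ib_ic_i+a_ia_{i+1}^2+b_ib_{i+1}^2+c_ic_{i+1}^2\right),$$ and denote also by $F$ the element of $P$ obtained by replacing each monomial $\mathbf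 x^{\mathbf e}$ by $\mathbf x^{[\mathbf e]}$. Then $\mathrm{Apolar}(F)$ satisfies the small tangent space condition. More precisely, let $I\subset S$ be the ideal generated by the following quadrics, where $x,y,z$ denote letters in $\{a,b,c\}$ and $i,j\in\mathbb Z/m$: - $x_iy_j$ for all $x,y$ and all $j\notin\{i-1,i,i+1\}$; - $x_iy_{i+1}-x_jy_{j+1}$ for all $x\neq y$ and all $i,j$; - $x_i^2-y_{i-1}z_{i-1}$ and $x_ix_{i+1}-y_{i+1}z_{i+1}$ for all $i$ and $\{x,y,z\}=\{a,b,c\}$. Let $J=I^2+\langle a_ia_{i+1}a_{i+2}^2,\ b_ib_{i+1}b_{i+2}^2,\ c_ic_{i+1}c_{i+2}^2 : i\in\mathbb Z/m\rangle$. Then $I\subseteq\mathrm{Ann}(F)$, every form of degree $4$ in $S$ lies in $J$, and every monomial of degree $5$ in $S$ lies in $I^2$. -/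

import Mathlib

namespace ApolarCubic

noncomputable section

open MvPolynomial

/-! Contraction, apolar ideals and Hilbert functions, over the polynomial ring
`S = MvPolynomial σ k` with graded dual `P`. -/

section General

/-- The module `P` of divided powers: the `k`-linear functionals on `S` that vanish on `(S₊)^N`
for some `N` (equivalently, for all large `N`), where `S₊` is the ideal of the variables. -/
def dividedPowers (σ k : Type*) [Field k] : Submodule k (Module.Dual k (MvPolynomial σ k)) where
  carrier := {f | ∃ N : ℕ, ∀ s ∈ idealOfVars σ k ^ N, f s = 0}
  zero_mem' := ⟨0, fun _ _ => rfl⟩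
  add_mem' := by
    rintro f g ⟨M, hM⟩ ⟨N, hN⟩
    refine ⟨M + N, fun s hs => ?_⟩
    have h1 := hM s (Ideal.pow_le_pow_right (Nat.le_add_right M N) hs)
    have h2 := hN s (Ideal.pow_le_pow_right (Nat.le_add_left N M) hs)
    simp [h1, h2]
  smul_mem' := by
    rintro c f ⟨N, hN⟩
    exact ⟨N, fun s hs => by simp [hN s hs]⟩

variable {σ k : Type*} [Field k]

/-- Contraction of `f ∈ P` by `s ∈ S`: the functional `t ↦ f (s t)`. -/
def contract (s : MvPolynomial σ k) : dividedPowers σ k →ₗ[k] dividedPowers σ k :=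
  (LinearMap.mulLeft k s).dualMap.restrict (by
    rintro f ⟨N, hN⟩
    exact ⟨N, fun t ht => hN _ (Ideal.mul_mem_left _ s ht)⟩)

theorem contract_apply (s : MvPolynomial σ k) (f : dividedPowers σ k) (t : MvPolynomial σ k) :
    (contract s f).1 t = f.1 (s * t) := rfl

/-- The divided power monomial `x^[a]`: the functional dual to the monomial with exponent `a`. -/
def dpMonomial (a : σ →₀ ℕ) : dividedPowers σ k :=
  ⟨lcoeff k a, a.degree + 1, fun s hs => by
    rw [lcoeff_apply]
    exact (mem_pow_idealOfVars_iff' _ s).1 hs a (Nat.lt_succ_self _)⟩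

/-- The usual formula for contraction on monomials. -/
theorem contract_monomial_dpMonomial [DecidableEq σ] (a b : σ →₀ ℕ) :
    contract (monomial b (1 : k)) (dpMonomial a) =
      if b ≤ a then dpMonomial (a - b) else 0 := by
  apply Subtype.ext
  apply LinearMap.ext
  intro t
  rw [contract_apply]
  split_ifs with h
  · simp [dpMonomial, lcoeff_apply, coeff_monomial_mul', h]
  · simp [dpMonomial, lcoeff_apply, coeff_monomial_mul', h]

/-- The elements of `P` that are homogeneous of degree `d`. -/
def homogeneousPart (σ k : Type*) [Field k] (d : ℕ) : Submodule k (dividedPowers σ k) :=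
  Submodule.span k {f | ∃ a : σ →₀ ℕ, a.degree = d ∧ f = dpMonomial a}

/-- The element `∑ c_a x^[a]` of `P` that is dual to the polynomial `∑ c_a x^a`. -/
def dualElement : MvPolynomial σ k →ₗ[k] dividedPowers σ k :=
  (basisMonomials σ k).constr k (dpMonomial (σ := σ) (k := k))

theorem dualElement_monomial (a : σ →₀ ℕ) (c : k) :
    dualElement (monomial a c) = c • dpMonomial a := by
  have h : dualElement (monomial a (1 : k)) = dpMonomial a := by
    have := (basisMonomials σ k).constr_basis k (dpMonomial (σ := σ) (k := k)) a
    simpa [dualElement] using this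
  rw [← h, ← map_smul, smul_monomial, smul_eq_mul, mul_one]

/-- The apolar ideal `Ann f`. -/
def Ann (f : dividedPowers σ k) : Ideal (MvPolynomial σ k) where
  carrier := {s | contract s f = 0}
  zero_mem' := by
    apply Subtype.ext
    apply LinearMap.ext
    intro t
    rw [contract_apply]
    simp
  add_mem' := by
    intro s t hs ht
    apply Subtype.ext
    apply LinearMap.ext
    intro u
    have h1 : f.1 (s * u) = 0 := by rw [← contract_apply, hs]; rfl
    have h2 : f.1 (t * u) = 0 := by rw [← contract_apply, ht]; rfl
    rw [contract_apply, add_mul, map_add, h1, h2]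
    simp
  smul_mem' := by
    intro r s hs
    apply Subtype.ext
    apply LinearMap.ext
    intro u
    have h1 : f.1 (s * (r * u)) = 0 := by rw [← contract_apply, hs]; rfl
    rw [contract_apply, smul_eq_mul, mul_comm r s, mul_assoc, h1]
    rfl

theorem mem_Ann (f : dividedPowers σ k) (s : MvPolynomial σ k) :
    s ∈ Ann f ↔ contract s f = 0 := Iff.rfl

/-- The Hilbert function of the graded algebra `S / I`, for a homogeneous ideal `I`:
its degree `d` part is the image of the forms of degree `d`. -/
def hilbert (I : Ideal (MvPolynomial σ k)) (d : ℕ) : ℕ :=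
  Module.finrank k
    ((homogeneousSubmodule σ k d).map (Ideal.Quotient.mkₐ k I).toLinearMap)

/-- The small tangent space condition for `Apolar f = S / Ann f`, where `f` is a cubic in `P` and
`S` has `n = Nat.card σ` variables. -/
structure SmallTangentSpace (f : dividedPowers σ k) : Prop where
  cubic : f ∈ homogeneousPart σ k 3
  hilbert_zero : hilbert (Ann f) 0 = 1
  hilbert_one : hilbert (Ann f) 1 = Nat.card σ
  hilbert_two : hilbert (Ann f) 2 = Nat.card σ
  hilbert_three : hilbert (Ann f) 3 = 1
  hilbert_large : ∀ d, 4 ≤ d → hilbert (Ann f) d = 0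
  sq_hilbert_four : hilbert (Ann f ^ 2) 4 = Nat.card σ
  sq_hilbert_five : hilbert (Ann f ^ 2) 5 = 0

end General

/-! The variables `a_i`, `b_i`, `c_i` are `X (0, i)`, `X (1, i)`, `X (2, i)` with `i : ZMod m`. -/

section Cubic

/-- The polynomial `∑ i, a_i b_i c_i + a_i a_{i+1}^2 + b_i b_{i+1}^2 + c_i c_{i+1}^2`. -/
def cubic (k : Type*) [Field k] (m : ℕ) [NeZero m] : MvPolynomial (Fin 3 × ZMod m) k :=
  ∑ i : ZMod m, (X (0, i) * X (1, i) * X (2, i) + X (0, i) * X (0, i + 1) ^ 2 +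
    X (1, i) * X (1, i + 1) ^ 2 + X (2, i) * X (2, i + 1) ^ 2)

/-- The polynomial above, viewed in the divided power module. -/
def cubicDual (k : Type*) [Field k] (m : ℕ) [NeZero m] : dividedPowers (Fin 3 × ZMod m) k :=
  dualElement (cubic k m)

/-- The quadrics generating the ideal `I`: here `x`, `y`, `z` are letters. -/
inductive IsQuadric (k : Type*) [Field k] (m : ℕ) : MvPolynomial (Fin 3 × ZMod m) k → Prop
  | far (x y : Fin 3) (i j : ZMod m) (h₁ : j ≠ i - 1) (h₂ : j ≠ i) (h₃ : j ≠ i + 1) :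
      IsQuadric k m (X (x, i) * X (y, j))
  | mixed (x y : Fin 3) (i j : ZMod m) (hxy : x ≠ y) :
      IsQuadric k m (X (x, i) * X (y, i + 1) - X (x, j) * X (y, j + 1))
  | square (x y z : Fin 3) (i : ZMod m) (hxy : x ≠ y) (hxz : x ≠ z) (hyz : y ≠ z) :
      IsQuadric k m (X (x, i) ^ 2 - X (y, i - 1) * X (z, i - 1))
  | next (x y z : Fin 3) (i : ZMod m) (hxy : x ≠ y) (hxz : x ≠ z) (hyz : y ≠ z) :
      IsQuadric k m (X (x, i) * X (x, i + 1) - X (y, i + 1) * X (z, i + 1))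

/-- The ideal `I`. -/
def quadricIdeal (k : Type*) [Field k] (m : ℕ) : Ideal (MvPolynomial (Fin 3 × ZMod m) k) :=
  Ideal.span {q | IsQuadric k m q}

/-- The ideal `J = I^2 + ⟨x_i x_{i+1} x_{i+2}^2 : x ∈ {a, b, c}, i ∈ ℤ/m⟩`. -/
def quarticIdeal (k : Type*) [Field k] (m : ℕ) : Ideal (MvPolynomial (Fin 3 × ZMod m) k) :=
  quadricIdeal k m ^ 2 ⊔
    Ideal.span {q | ∃ (x : Fin 3) (i : ZMod m), q = X (x, i) * X (x, i + 1) * X (x, i + 2) ^ 2}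

end Cubic

end

end ApolarCubic

/-! Modulo I² the generators of I span an ideal of square zero, so multiplying by an element of I
turns a congruence modulo I into an equality. Call a product of two variables far if their positions
are neither equal nor adjacent, and mixed if distinct letters sit at consecutive positions. Far
pairs lie in I, and mixed pairs with the same ordered letters are congruent. Every other product of
two variables is congruent to two distinct letters at one position (`pair_induction`). Quartics
vanish by regrouping their factors and sliding mixed pairs around the cycle until two far pairs
appear.

The one obstruction is x_s T_i, with T_i = a_i b_i c_i and i far from s. It does not depend on i and
equals x_s x_{s+1} x_{s+2}². Modulo J these quartics vanish, and then so does everything of degree 4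
(`quartic_eq_zero`). Modulo I² each is killed by every variable, because i can be chosen to suit
that variable (`quartic_mul_eq_zero`); hence degree 5 lies in I².

For the Hilbert functions, I ⊆ Ann(F), so the n quartics span degree 4 modulo Ann(F)². By the
Leibniz rule the functionals s ↦ F(∂s/∂p) vanish on Ann(F)², and they are dual to these quartics,
whence the value is exactly n. The values for Ann(F) come from explicit dual families in the same
way. -/

namespace ApolarCubic

/-- The positions `i` and `j` on the cycle `ZMod m` are neither equal nor adjacent. -/
def Far {m : ℕ} (i j : ZMod m) : Prop := j ≠ i - 1 ∧ j ≠ i ∧ j ≠ i + 1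

theorem Far.symm {m : ℕ} {i j : ZMod m} (h : Far i j) : Far j i := by
  unfold Far at *
  grind

/-- Separates positions whose distance along the cycle is at most 5, in a form fed to `grind`. -/
theorem exists_one_mul_ne_zero {m : ℕ} (hm : 6 ≤ m) : ∃ e : ZMod m, e = 1 ∧ e ≠ 0 ∧
    e * 2 ≠ 0 ∧ e * 3 ≠ 0 ∧ e * 4 ≠ 0 ∧ e * 5 ≠ 0 := by
  have key : ∀ n : ℕ, 0 < n → n < 6 → (n : ZMod m) ≠ 0 := by
    intro n h0 h6 h
    rw [ZMod.natCast_eq_zero_iff] at h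
    exact absurd (Nat.le_of_dvd h0 h) (by omega)
  refine ⟨1, rfl, ?_, ?_, ?_, ?_, ?_⟩
  · exact_mod_cast key 1 (by norm_num) (by norm_num)
  · simpa using key 2 (by norm_num) (by norm_num)
  · simpa using key 3 (by norm_num) (by norm_num)
  · simpa using key 4 (by norm_num) (by norm_num)
  · simpa using key 5 (by norm_num) (by norm_num)

/-- Elements `v x i` of a ring `R` that satisfy, modulo an ideal `A` of square zero, the relations
given by the quadrics. -/
structure QuadricRelations {m : ℕ} {R : Type*} [CommRing R] (v : Fin 3 → ZMod m → R)
    (A : Ideal R) : Prop where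
  far : ∀ x y i j, Far i j → v x i * v y j ∈ A
  mixed : ∀ x y i j, x ≠ y → v x i * v y (i + 1) - v x j * v y (j + 1) ∈ A
  square : ∀ x i, v (x + 1) i * v (x + 2) i - v x (i + 1) * v x (i + 1) ∈ A
  next : ∀ x i, v (x + 1) i * v (x + 2) i - v x (i - 1) * v x i ∈ A
  mul_eq_zero : ∀ p ∈ A, ∀ q ∈ A, p * q = 0
  six_le : 6 ≤ m

/-! ### Products with a far pair -/

namespace QuadricRelations

variable {m : ℕ} {R : Type*} [CommRing R] {v : Fin 3 → ZMod m → R} {A : Ideal R}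

theorem far_far (h : QuadricRelations v A) {i j p q : ZMod m} (hij : Far i j) (hpq : Far p q)
    (x y z w : Fin 3) : v x i * v y j * (v z p * v w q) = 0 :=
  h.mul_eq_zero _ (h.far x y i j hij) _ (h.far z w p q hpq)

/-- A far pair kills every mixed pair. -/
theorem far_mixed (h : QuadricRelations v A) {p s : ZMod m} (hps : Far p s) (u w x y : Fin 3)
    (hxy : x ≠ y) (i : ZMod m) : v u p * v w s * (v x i * v y (i + 1)) = 0 := by
  obtain ⟨e₀, he₀, h1, h2, h3, h4, h5⟩ := exists_one_mul_ne_zero h.six_le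
  have key : ∀ j, v u p * v w s * (v x j * v y (j + 1)) = 0 →
      v u p * v w s * (v x i * v y (i + 1)) = 0 := by
    intro j hj
    have := h.mul_eq_zero _ (h.far u w p s hps) _ (h.mixed x y i j hxy)
    linear_combination this + hj
  -- The mixed pair is slid to a position where its factors are far from `p` and `s` respectively.
  -- The choice `p + 2` fails only when `s` is within one step of `p + 3`; the three exceptions are
  -- treated separately.
  by_cases c2 : s = p + 2
  · refine key (p + 3) ?_
    have := h.far_far (i := p) (j := p + 3) (p := s) (q := p + 3 + 1)
      (by unfold Far; grind) (by unfold Far; grind) u x w y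
    linear_combination this
  by_cases c3 : s = p + 3
  · refine key (p - 2) ?_
    have := h.far_far (i := p) (j := p - 2) (p := s) (q := p - 2 + 1)
      (by unfold Far; grind) (by unfold Far; grind) u x w y
    linear_combination this
  by_cases c4 : s = p + 4
  · refine key (p + 1) ?_
    have := h.far_far (i := p) (j := p + 1 + 1) (p := s) (q := p + 1)
      (by unfold Far; grind) (by unfold Far; grind) u y w x
    linear_combination this
  · refine key (p + 2) ?_
    have := h.far_far (i := p) (j := p + 2) (p := s) (q := p + 2 + 1)
      (by unfold Far; grind) (by unfold Far; grind) u x w y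
    linear_combination this

/-- A far pair lies in `A`, so the congruence `next` becomes an equality after multiplication by it.
-/
theorem far_next (h : QuadricRelations v A) {p s : ZMod m} (hps : Far p s) (u w x : Fin 3)
    (i : ZMod m) :
    v u p * v w s * (v (x + 1) i * v (x + 2) i) = v u p * v w s * (v x (i - 1) * v x i) := by
  linear_combination h.mul_eq_zero _ (h.far u w p s hps) _ (h.next x i)

theorem far_square (h : QuadricRelations v A) {p s : ZMod m} (hps : Far p s) (u w x : Fin 3)
    (i : ZMod m) : v u p * v w s * (v (x + 1) i * v (x + 2) i) =
      v u p * v w s * (v x (i + 1) * v x (i + 1)) := by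
  linear_combination h.mul_eq_zero _ (h.far u w p s hps) _ (h.square x i)

theorem prod_letters (v : Fin 3 → ZMod m → R) (x : Fin 3) (i : ZMod m) :
    v x i * (v (x + 1) i * v (x + 2) i) = v 0 i * v 1 i * v 2 i := by
  fin_cases x
  · simp [mul_assoc]
  · simp [show (1 : Fin 3) + 2 = 0 from rfl, show (1 : Fin 3) + 1 = 2 from rfl]
    ring
  · simp [show (2 : Fin 3) + 1 = 0 from rfl, show (2 : Fin 3) + 2 = 1 from rfl]
    ring

/-- A letter times the product of the three letters at the second next position. -/
theorem letter_mul_triple_base (h : QuadricRelations v A) (w : Fin 3) (s : ZMod m) :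
    v w s * (v 0 (s + 2) * v 1 (s + 2) * v 2 (s + 2)) =
      v w s * v w (s + 1) * v w (s + 2) ^ 2 := by
  obtain ⟨e₀, he₀, h1, h2, h3, h4, h5⟩ := exists_one_mul_ne_zero h.six_le
  have := h.far_next (p := s) (s := s + 2) (by unfold Far; grind) w w w (s + 2)
  rw [← prod_letters v w]
  rw [show s + 2 - 1 = s + 1 by ring] at this
  linear_combination this

/-- Both sides reduce to w_s w_i w_{i+1}²: the left by `next` at i+1, the right by `square` at i. -/
theorem letter_mul_triple_succ (h : QuadricRelations v A) (w : Fin 3) (s i : ZMod m)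
    (hi : Far s i) (hi' : Far s (i + 1)) :
    v w s * (v 0 (i + 1) * v 1 (i + 1) * v 2 (i + 1)) = v w s * (v 0 i * v 1 i * v 2 i) := by
  have e1 := h.far_next hi' w w w (i + 1)
  have e2 := h.far_square hi w w w i
  rw [← prod_letters v w i, ← prod_letters v w (i + 1)]
  rw [add_sub_cancel_right] at e1
  linear_combination e1 - e2

theorem exists_not_mem_four (hm : 6 ≤ m) (a b c d : ZMod m) :
    ∃ l : ZMod m, l ≠ a ∧ l ≠ b ∧ l ≠ c ∧ l ≠ d := by
  have : NeZero m := ⟨by omega⟩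
  by_contra hcon
  push Not at hcon
  have hsub : (Finset.univ : Finset (ZMod m)) ⊆ {a, b, c, d} := by
    intro l _
    simp only [Finset.mem_insert, Finset.mem_singleton]
    by_contra hl
    push Not at hl
    exact hl.2.2.2 (hcon l hl.1 hl.2.1 hl.2.2.1)
  have hc := Finset.card_le_card hsub
  rw [Finset.card_univ, ZMod.card] at hc
  have := Finset.card_le_four (a := a) (b := b) (c := c) (d := d)
  omega

/-! Now the monomials `x_i x_{i+1} x_{i+2}^2` are assumed to vanish. -/

theorem letter_mul_triple (h : QuadricRelations v A)
    (hq : ∀ x i, v x i * v x (i + 1) * v x (i + 2) ^ 2 = 0) (w : Fin 3) (s i : ZMod m)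
    (hi : Far s i) : v w s * (v 0 i * v 1 i * v 2 i) = 0 := by
  obtain ⟨e₀, he₀, h1, h2, h3, h4, h5⟩ := exists_one_mul_ne_zero h.six_le
  have : NeZero m := ⟨by have := h.six_le; omega⟩
  have key : ∀ r : ℕ, r + 4 ≤ m →
      v w s * (v 0 (s + 2 + r) * v 1 (s + 2 + r) * v 2 (s + 2 + r)) = 0 := by
    intro r
    -- The bound on `r` keeps the position strictly before s - 1 on the way round the cycle.
    have hfar : ∀ r : ℕ, r + 4 ≤ m → Far s (s + 2 + r) := by
      intro r hr
      have key : ∀ n : ℕ, 0 < n → n < m → (n : ZMod m) ≠ 0 := by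
        intro n h0 h6 h
        rw [ZMod.natCast_eq_zero_iff] at h
        exact absurd (Nat.le_of_dvd h0 h) (by omega)
      have k1 := key (r + 3) (by omega) (by omega)
      have k2 := key (r + 2) (by omega) (by omega)
      have k3 := key (r + 1) (by omega) (by omega)
      push_cast at k1 k2 k3
      refine ⟨fun e => k1 ?_, fun e => k2 ?_, fun e => k3 ?_⟩ <;> linear_combination e
    induction r with
    | zero =>
      intro _
      have := h.letter_mul_triple_base w s
      rw [hq] at this
      simpa using this
    | succ r ih =>
      intro hr
      have e := h.letter_mul_triple_succ w s (s + 2 + r) (hfar r (by omega))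
        (by have := hfar (r + 1) hr; push_cast at this; rwa [← add_assoc] at this)
      push_cast
      rw [← add_assoc, e]
      exact ih (by omega)
  have hval : ((i - s - 2).val : ZMod m) = i - s - 2 := ZMod.natCast_zmod_val _
  have hlt := ZMod.val_lt (i - s - 2)
  by_cases hr : (i - s - 2).val + 4 ≤ m
  · have := key _ hr
    rwa [hval, show s + 2 + (i - s - 2) = i by ring] at this
  · exfalso
    obtain ⟨f1, f2, f3⟩ := hi
    have hm0 : (m : ZMod m) = 0 := ZMod.natCast_self m
    -- These residues are i = s + 1, s, s - 1, all excluded by `Far s i`.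
    have hcase : (i - s - 2).val + 1 = m ∨ (i - s - 2).val + 2 = m ∨
      (i - s - 2).val + 3 = m := by omega
    rcases hcase with e | e | e
    · have := congrArg (Nat.cast : ℕ → ZMod m) e
      push_cast at this
      rw [hval, hm0] at this
      exact f3 (by linear_combination this)
    · have := congrArg (Nat.cast : ℕ → ZMod m) e
      push_cast at this
      rw [hval, hm0] at this
      exact f2 (by linear_combination this)
    · have := congrArg (Nat.cast : ℕ → ZMod m) e
      push_cast at this
      rw [hval, hm0] at this
      exact f1 (by linear_combination this)

/-- If u = x, the three letters at i form T_i. Otherwise `next` brings in x_{i-1}, which makes a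
mixed pair with u_i, while x_i and w_s remain far. -/
theorem far_mul_of_eq (h : QuadricRelations v A)
    (hq : ∀ x i, v x i * v x (i + 1) * v x (i + 2) ^ 2 = 0) {i s : ZMod m} (hs : Far i s)
    (u w x : Fin 3) : v u i * v w s * (v (x + 1) i * v (x + 2) i) = 0 := by
  by_cases hux : u = x
  · subst hux
    have := h.letter_mul_triple hq w s i hs.symm
    rw [← prod_letters v u] at this
    linear_combination this
  · rw [h.far_next hs]
    have := h.far_mixed hs x w x u (Ne.symm hux) (i - 1)
    rw [sub_add_cancel] at this
    linear_combination this

theorem letter_ne_add_one (x : Fin 3) : x ≠ x + 1 := by decide +revert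
theorem letter_ne_add_two (x : Fin 3) : x ≠ x + 2 := by decide +revert
theorem letter_add_one_ne_add_two (x : Fin 3) : x + 1 ≠ x + 2 := by decide +revert

theorem letter_add (x : Fin 3) :
    x + 1 + 1 = x + 2 ∧ x + 1 + 2 = x ∧ x + 2 + 1 = x ∧ x + 2 + 2 = x + 1 := by decide +revert

theorem third_letter (x y : Fin 3) (hxy : x ≠ y) :
    ∃ z : Fin 3, (x = z + 1 ∧ y = z + 2) ∨ (x = z + 2 ∧ y = z + 1) := by decide +revert

theorem neighbours_mul (h : QuadricRelations v A) (i : ZMod m) (u w x : Fin 3) :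
    v u (i + 1) * v w (i - 1) * (v (x + 1) i * v (x + 2) i) = 0 := by
  obtain ⟨e₀, he₀, h1, h2, h3, h4, h5⟩ := exists_one_mul_ne_zero h.six_le
  have hf : Far (i + 1) (i - 1) := by unfold Far; grind
  by_cases hux : u = x
  · subst hux
    rw [h.far_next hf]
    by_cases hw : w = u
    · subst hw
      -- The target w_{i-1}² w_i w_{i+1} is one of the four terms of this product; each of the
      -- others regroups into two far pairs.
      have e := h.mul_eq_zero _ (h.square w (i - 2)) _ (h.next w (i + 1))
      rw [add_sub_cancel_right, show i - 2 + 1 = i - 1 by ring] at e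
      have e1 := h.far_far (i := i - 2) (j := i + 1) (p := i - 2) (q := i + 1)
        (by unfold Far; grind) (by unfold Far; grind) (w + 1) (w + 1) (w + 2) (w + 2)
      have e2 := h.far_far (i := i - 2) (j := i) (p := i - 2) (q := i + 1)
        (by unfold Far; grind) (by unfold Far; grind) (w + 1) w (w + 2) w
      have e3 := h.far_far hf hf (w + 1) w (w + 2) w
      linear_combination e - e1 + e2 + e3
    · have := h.far_mixed hf u u w u hw (i - 1)
      rw [sub_add_cancel] at this
      linear_combination this
  · rw [h.far_square hf]
    -- One x_{i+1} stays with w_{i-1} as a far pair, which turns u_{i+1} x_{i+1} into z_i z_{i+1}.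
    -- Then z_i and the remaining x_{i+1} form a mixed pair.
    obtain ⟨z, ⟨hu, hx⟩ | ⟨hu, hx⟩⟩ := third_letter u x hux
    · have e1 := h.far_next hf x w z (i + 1)
      have e2 := h.far_mixed hf z w z x (hx ▸ letter_ne_add_two z) i
      rw [add_sub_cancel_right, ← hu, ← hx] at e1
      linear_combination e1 + e2
    · have e1 := h.far_next hf x w z (i + 1)
      have e2 := h.far_mixed hf z w z x (hx ▸ letter_ne_add_one z) i
      rw [add_sub_cancel_right, ← hu, ← hx] at e1
      linear_combination e1 + e2

/-- At least one of the two letters at i differs from u and makes a mixed pair with u_p; the other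
is far from w_s. -/
theorem adjacent_far (h : QuadricRelations v A) {i p s : ZMod m} (hp : p = i + 1 ∨ p = i - 1)
    (hs : Far i s) (u w x : Fin 3) :
    v u p * v w s * (v (x + 1) i * v (x + 2) i) = 0 := by
  have key : ∀ y z : Fin 3, y ≠ u → v u p * v w s * (v y i * v z i) = 0 := by
    intro y z hy
    rcases hp with rfl | rfl
    · linear_combination h.far_mixed hs z w y u hy i
    · have := h.far_mixed hs z w u y hy.symm (i - 1)
      rw [sub_add_cancel] at this
      linear_combination this
  by_cases hu : x + 1 = u
  · have := key (x + 2) (x + 1) (fun e => letter_add_one_ne_add_two x (hu.trans e.symm))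
    linear_combination this
  · exact key _ _ hu

/-- A far pair kills the product of two distinct letters at one position. -/
theorem far_mul_letters (h : QuadricRelations v A)
    (hq : ∀ x i, v x i * v x (i + 1) * v x (i + 2) ^ 2 = 0) {p s : ZMod m} (hps : Far p s)
    (u w x : Fin 3) (i : ZMod m) : v u p * v w s * (v (x + 1) i * v (x + 2) i) = 0 := by
  by_cases c0 : p = i
  · subst c0
    exact h.far_mul_of_eq hq hps u w x
  by_cases c0' : s = i
  · subst c0'
    rw [mul_comm (v u p)]
    exact h.far_mul_of_eq hq hps.symm w u x
  by_cases cp : Far i p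
  · by_cases cs : Far i s
    · linear_combination h.far_far cp cs (x + 1) u (x + 2) w
    · rw [mul_comm (v u p)]
      exact h.adjacent_far (by unfold Far at cs; grind) cp w u x
  · by_cases cs : Far i s
    · exact h.adjacent_far (by unfold Far at cp; grind) cs u w x
    · have hp : p = i + 1 ∨ p = i - 1 := by unfold Far at cp; grind
      have hs : s = i + 1 ∨ s = i - 1 := by unfold Far at cs; grind
      rcases hp with rfl | rfl <;> rcases hs with rfl | rfl
      · exact absurd rfl hps.2.1
      · exact h.neighbours_mul i u w x
      · rw [mul_comm (v u _)]
        exact h.neighbours_mul i w u x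
      · exact absurd rfl hps.2.1

/-- Every product of two variables is a far pair, a mixed pair, or congruent to the product of two
letters at one position. -/
theorem pair_induction {C : R → Prop} (v : Fin 3 → ZMod m → R)
    (hfar : ∀ x y i j, Far i j → C (v x i * v y j))
    (hmixed : ∀ x y i, x ≠ y → C (v x i * v y (i + 1)))
    (hletters : ∀ x i, C (v (x + 1) i * v (x + 2) i))
    (hsquare : ∀ x i, C (v x (i + 1) * v x (i + 1)))
    (hnext : ∀ x i, C (v x (i - 1) * v x i)) (x y : Fin 3) (i j : ZMod m) :
    C (v x i * v y j) := by
  have hadj : ∀ x y i, C (v x i * v y (i + 1)) := by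
    intro x y i
    by_cases hxy : x = y
    · subst hxy
      simpa using hnext x (i + 1)
    · exact hmixed x y i hxy
  by_cases hij : Far i j
  · exact hfar x y i j hij
  have : j = i ∨ j = i + 1 ∨ i = j + 1 := by unfold Far at hij; grind
  rcases this with rfl | rfl | rfl
  · by_cases hxy : x = y
    · subst hxy
      simpa using hsquare x (j - 1)
    · obtain ⟨z, ⟨rfl, rfl⟩ | ⟨rfl, rfl⟩⟩ := third_letter x y hxy
      · exact hletters z j
      · rw [mul_comm]
        exact hletters z j
  · exact hadj x y i
  · rw [mul_comm]
    exact hadj y x j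

/-- A far pair kills every product of two variables. -/
theorem far_mul (h : QuadricRelations v A)
    (hq : ∀ x i, v x i * v x (i + 1) * v x (i + 2) ^ 2 = 0) {p s : ZMod m} (hps : Far p s)
    (u w x y : Fin 3) (i j : ZMod m) : v u p * v w s * (v x i * v y j) = 0 := by
  refine pair_induction (C := fun r => v u p * v w s * r = 0) v ?_ ?_ ?_ ?_ ?_ x y i j
  · exact fun x y i j hij => h.far_far hps hij u w x y
  · exact fun x y i hxy => h.far_mixed hps u w x y hxy i
  · exact fun x i => h.far_mul_letters hq hps u w x i
  · exact fun x i => by rw [← h.far_square hps, h.far_mul_letters hq hps u w x i]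
  · exact fun x i => by rw [← h.far_next hps, h.far_mul_letters hq hps u w x i]

/-! ### Products with a mixed pair -/

/-- A position off {l, l + 1} is far from at least one of the two. -/
theorem mixed_far (h : QuadricRelations v A)
    (hq : ∀ x i, v x i * v x (i + 1) * v x (i + 2) ^ 2 = 0) {l p : ZMod m} (h1 : p ≠ l)
    (h2 : p ≠ l + 1) (x y c d : Fin 3) (q : ZMod m) :
    v x l * v y (l + 1) * (v c p * v d q) = 0 := by
  by_cases hp : Far l p
  · linear_combination h.far_mul hq hp x c y d (l + 1) q
  · have hp' : Far (l + 1) p := by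
      obtain ⟨e₀, he₀, n1, n2, n3, n4, n5⟩ := exists_one_mul_ne_zero h.six_le
      unfold Far at *
      grind
    linear_combination h.far_mul hq hp' y c x d l q

/-- A mixed pair need not lie in `A`, but its difference from a mixed pair at `l` does. With `l`
chosen to avoid p and p', the copy at `l` kills both products by `mixed_far`. -/
theorem mixed_congr (h : QuadricRelations v A)
    (hq : ∀ x i, v x i * v x (i + 1) * v x (i + 2) ^ 2 = 0) (x y : Fin 3) (hxy : x ≠ y)
    (i : ZMod m) {a b c d : Fin 3} {p q p' q' : ZMod m}
    (hA : v a p * v b q - v c p' * v d q' ∈ A) :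
    v x i * v y (i + 1) * (v a p * v b q) = v x i * v y (i + 1) * (v c p' * v d q') := by
  obtain ⟨l, l1, l2, l3, l4⟩ := exists_not_mem_four h.six_le p (p - 1) p' (p' - 1)
  have e1 := h.mixed_far hq (l := l) (p := p) l1.symm (by grind) x y a b q
  have e2 := h.mixed_far hq (l := l) (p := p') l3.symm (by grind) x y c d q'
  linear_combination h.mul_eq_zero _ (h.mixed x y i l hxy) _ hA + e1 - e2

/-- A mixed pair kills every product of two variables. -/
theorem mixed_mul (h : QuadricRelations v A)
    (hq : ∀ x i, v x i * v x (i + 1) * v x (i + 2) ^ 2 = 0) (x y : Fin 3) (hxy : x ≠ y)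
    (i : ZMod m) (c d : Fin 3) (p q : ZMod m) :
    v x i * v y (i + 1) * (v c p * v d q) = 0 := by
  obtain ⟨e₀, he₀, n1, n2, n3, n4, n5⟩ := exists_one_mul_ne_zero h.six_le
  have hletters : ∀ z j, v x i * v y (i + 1) * (v (z + 1) j * v (z + 2) j) = 0 := by
    intro z j
    -- When j is i or i + 1, the two letters are exchanged for a product involving position i - 1 or
    -- i + 2, off the mixed pair.
    by_cases c1 : j = i
    · rw [h.mixed_congr hq x y hxy i (h.next z j)]
      exact h.mixed_far hq (by grind) (by grind) _ _ _ _ _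
    by_cases c2 : j = i + 1
    · rw [h.mixed_congr hq x y hxy i (h.square z j)]
      exact h.mixed_far hq (by grind) (by grind) _ _ _ _ _
    · exact h.mixed_far hq c1 c2 _ _ _ _ _
  refine pair_induction (C := fun r => v x i * v y (i + 1) * r = 0) v ?_ ?_ ?_ ?_ ?_ c d p q
  · intro z w j l hjl
    linear_combination h.far_mixed hjl z w x y hxy i
  · intro z w j hzw
    rw [h.mixed_congr hq x y hxy i (h.mixed z w j (i + 2) hzw)]
    exact h.mixed_far hq (by grind) (by grind) _ _ _ _ _
  · exact hletters
  · exact fun z j => by rw [← h.mixed_congr hq x y hxy i (h.square z j), hletters]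
  · exact fun z j => by rw [← h.mixed_congr hq x y hxy i (h.next z j), hletters]

/-! ### The remaining quartics and degree five -/

/-- If p is adjacent to i, one of the two letters differs from c and completes a mixed pair. -/
theorem letters_mul_ne (h : QuadricRelations v A)
    (hq : ∀ x i, v x i * v x (i + 1) * v x (i + 2) ^ 2 = 0) (x c d : Fin 3) (i p q : ZMod m)
    (hp : p ≠ i) : v (x + 1) i * v (x + 2) i * (v c p * v d q) = 0 := by
  by_cases hf : Far i p
  · linear_combination h.far_mul hq hf (x + 1) c (x + 2) d i q
  have hadj : i + 1 = p ∨ p + 1 = i := by unfold Far at hf; grind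
  have key : ∀ y z : Fin 3, y ≠ c → v y i * v z i * (v c p * v d q) = 0 := by
    intro y z hy
    rcases hadj with rfl | rfl
    · linear_combination h.mixed_mul hq y c hy i z d i q
    · linear_combination h.mixed_mul hq c y hy.symm p z d (p + 1) q
  by_cases hc : x + 1 = c
  · have := key (x + 2) (x + 1) (fun e => letter_add_one_ne_add_two x (hc.trans e.symm))
    linear_combination this
  · exact key _ _ hc

/-- All products of four variables vanish. -/
theorem quartic_eq_zero (h : QuadricRelations v A)
    (hq : ∀ x i, v x i * v x (i + 1) * v x (i + 2) ^ 2 = 0) (x y c d : Fin 3)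
    (i j p q : ZMod m) : v x i * v y j * (v c p * v d q) = 0 := by
  obtain ⟨e₀, he₀, n1, n2, n3, n4, n5⟩ := exists_one_mul_ne_zero h.six_le
  have hne1 : ∀ i : ZMod m, i - 1 ≠ i := by grind
  have hne2 : ∀ i : ZMod m, i + 1 ≠ i := by grind
  have hfar : ∀ i : ZMod m, Far (i - 1) (i + 1) := by unfold Far; grind
  clear n1 n2 n3 n4 n5 he₀ e₀
  have hln : ∀ x y i j, v (x + 1) i * v (x + 2) i * (v y (j - 1) * v y j) = 0 := by
    intro x y i j
    by_cases hj : j = i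
    · exact h.letters_mul_ne hq _ _ _ _ _ _ (hj ▸ hne1 j)
    · rw [mul_comm (v y (j - 1))]
      exact h.letters_mul_ne hq _ _ _ _ _ _ hj
  have hll : ∀ x y i j, v (x + 1) i * v (x + 2) i * (v (y + 1) j * v (y + 2) j) = 0 := by
    intro x y i j
    by_cases hj : j = i
    · subst hj
      -- The other three terms of this product involve a second position and are already known to
      -- vanish.
      have e := h.mul_eq_zero _ (h.square x j) _ (h.next y j)
      have e1 := hln x y j j
      have e2 := h.letters_mul_ne hq y x x j (j + 1) (j + 1) (hne2 j)
      have e3 := h.far_mul hq (p := j - 1) (s := j + 1) (hfar j) y x x y (j + 1) j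
      linear_combination e + e1 + e2 - e3
    · exact h.letters_mul_ne hq _ _ _ _ _ _ hj
  have hnn : ∀ x y i j, v x (i - 1) * v x i * (v y (j - 1) * v y j) = 0 := by
    intro x y i j
    have e := h.mul_eq_zero _ (h.next x i) _ (h.next y j)
    linear_combination e + hln x y i j + hln y x j i - hll x y i j
  have hsn : ∀ x y i j, v x (i + 1) * v x (i + 1) * (v y (j - 1) * v y j) = 0 := by
    intro x y i j
    have e := h.mul_eq_zero _ (h.square x i) _ (h.next y j)
    by_cases hj : j = i + 1
    · subst hj
      rw [add_sub_cancel_right] at e ⊢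
      by_cases hxy : y = x
      · subst hxy
        have e1 := hln y y i (i + 1)
        have e2 := hll y y i (i + 1)
        -- The cross term, y_{i+1}² times the other two letters there, regroups into two products of
        -- distinct letters.
        have e3 := hll (y + 1) (y + 2) (i + 1) (i + 1)
        obtain ⟨l1, l2, l3, l4⟩ := letter_add y
        rw [l1, l2, l3, l4] at e3
        rw [add_sub_cancel_right] at e1
        linear_combination e + e1 - e2 + e3
      · linear_combination h.mixed_mul hq y x hxy i x y (i + 1) (i + 1)
    · have e2 := h.letters_mul_ne hq y x x j (i + 1) (i + 1) (Ne.symm hj)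
      linear_combination e + hln x y i j + e2 - hll x y i j
  have hls : ∀ x y i j, v (x + 1) i * v (x + 2) i * (v y (j + 1) * v y (j + 1)) = 0 := by
    intro x y i j
    have e := h.mul_eq_zero _ (h.next x i) _ (h.square y j)
    linear_combination (-1 : R) * e + hll x y i j - hln y x j i + hsn y x j i
  have hss : ∀ x y i j,
      v x (i + 1) * v x (i + 1) * (v y (j + 1) * v y (j + 1)) = 0 := by
    intro x y i j
    have e := h.mul_eq_zero _ (h.square x i) _ (h.square y j)
    linear_combination e - hll x y i j + hls x y i j + hls y x j i
  have hfirst : ∀ x i, (∀ c d p q, v (x + 1) i * v (x + 2) i * (v c p * v d q) = 0) ∧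
      (∀ c d p q, v x (i + 1) * v x (i + 1) * (v c p * v d q) = 0) ∧
      (∀ c d p q, v x (i - 1) * v x i * (v c p * v d q) = 0) := by
    intro x i
    refine ⟨fun c d p q => ?_, fun c d p q => ?_, fun c d p q => ?_⟩
    · refine pair_induction (C := fun r => v (x + 1) i * v (x + 2) i * r = 0) v
        (fun _ _ _ _ hf => ?_) (fun _ _ _ hf => ?_) (hll x · i) (hls x · i) (hln x · i) c d p q
      · rw [mul_comm, h.far_mul hq hf]
      · rw [mul_comm, h.mixed_mul hq _ _ hf]
    · refine pair_induction (C := fun r => v x (i + 1) * v x (i + 1) * r = 0) v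
        (fun _ _ _ _ hf => ?_) (fun _ _ _ hf => ?_) (fun y j => ?_) (hss x · i) (hsn x · i)
        c d p q
      · rw [mul_comm, h.far_mul hq hf]
      · rw [mul_comm, h.mixed_mul hq _ _ hf]
      · rw [mul_comm, hls]
    · refine pair_induction (C := fun r => v x (i - 1) * v x i * r = 0) v
        (fun _ _ _ _ hf => ?_) (fun _ _ _ hf => ?_) (fun y j => ?_) (fun y j => ?_) (hnn x · i)
        c d p q
      · rw [mul_comm, h.far_mul hq hf]
      · rw [mul_comm, h.mixed_mul hq _ _ hf]
      · rw [mul_comm, hln]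
      · rw [mul_comm, hsn]
  refine pair_induction (C := fun r => r * (v c p * v d q) = 0) v
    (fun _ _ _ _ hf => ?_) (fun _ _ _ hf => ?_) (fun x i => (hfirst x i).1 c d p q)
    (fun x i => (hfirst x i).2.1 c d p q) (fun x i => (hfirst x i).2.2 c d p q) x y i j
  · exact h.far_mul hq hf _ _ _ _ _ _
  · exact h.mixed_mul hq _ _ hf _ _ _ _ _

/-- The monomials `x_i x_{i+1} x_{i+2}^2` are killed by all variables. -/
theorem quartic_mul_eq_zero (h : QuadricRelations v A) (w u : Fin 3) (s t : ZMod m) :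
    v w s * v w (s + 1) * v w (s + 2) ^ 2 * v u t = 0 := by
  obtain ⟨e₀, he₀, n1, n2, n3, n4, n5⟩ := exists_one_mul_ne_zero h.six_le
  have far2 : Far s (s + 2) := by unfold Far; grind
  have far3 : Far s (s + 2 + 1) := by unfold Far; grind
  have far4 : Far s (s + 2 + 1 + 1) := by unfold Far; grind
  -- The quartic equals w_s T_i for i = s+2, s+3, s+4; i is chosen according to `t` so that u_t
  -- makes a far pair with a letter of T_i, or a mixed pair when t = s + 3.
  have e2 := h.letter_mul_triple_base w s
  have e3 := h.letter_mul_triple_succ w s (s + 2) far2 far3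
  have e4 := h.letter_mul_triple_succ w s (s + 2 + 1) far3 far4
  by_cases c1 : t = s + 1
  · have := h.far_far far3 (p := t) (q := s + 2 + 1) (by unfold Far; grind) w 0 u 1
    linear_combination (-v u t) * e2 - v u t * e3 + v 2 (s + 2 + 1) * this
  by_cases c2 : t = s + 2
  · have := h.far_far far4 (p := t) (q := s + 2 + 1 + 1) (by unfold Far; grind) w 0 u 1
    linear_combination (-v u t) * e2 - v u t * e3 - v u t * e4 + v 2 (s + 2 + 1 + 1) * this
  by_cases c3 : t = s + 2 + 1
  · subst c3
    rw [← e2]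
    by_cases hu : u = 0
    · have := h.far_mixed far2 w 0 1 u (by rw [hu]; decide) (s + 2)
      linear_combination v 2 (s + 2) * this
    · have := h.far_mixed far2 w 1 0 u (Ne.symm hu) (s + 2)
      linear_combination v 2 (s + 2) * this
  · have := h.far_far far2 (p := t) (q := s + 2) (by unfold Far; grind) w 0 u 1
    linear_combination (-v u t) * e2 + v 2 (s + 2) * this

end QuadricRelations

open MvPolynomial

/-! Hilbert functions from dual families. -/

section General

variable {σ k : Type*} [Field k]

theorem exists_eq_single_add_of_degree {e : σ →₀ ℕ} {n : ℕ} (he : e.degree = n + 1) :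
    ∃ (p : σ) (e' : σ →₀ ℕ), e'.degree = n ∧ e = Finsupp.single p 1 + e' := by
  classical
  have hne : e ≠ 0 := by
    rintro rfl
    simp at he
  obtain ⟨p, hp⟩ := Finsupp.ne_iff.1 hne
  have hle : Finsupp.single p 1 ≤ e := by
    rw [Finsupp.single_le_iff]
    exact Nat.one_le_iff_ne_zero.2 hp
  have hadd : Finsupp.single p 1 + (e - Finsupp.single p 1) = e := add_tsub_cancel_of_le hle
  refine ⟨p, e - Finsupp.single p 1, ?_, hadd.symm⟩
  have := congrArg Finsupp.degree hadd
  rw [map_add, Finsupp.degree_single, he] at this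
  omega

theorem monomial_single_add_one (p : σ) (e : σ →₀ ℕ) :
    (monomial (Finsupp.single p 1 + e) 1 : MvPolynomial σ k) = X p * monomial e 1 := by
  rw [X, monomial_mul, one_mul]

theorem exists_monomial_eq_X_mul {e : σ →₀ ℕ} {n : ℕ} (he : e.degree = n + 1) :
    ∃ (p : σ) (e' : σ →₀ ℕ), e'.degree = n ∧
      (monomial e 1 : MvPolynomial σ k) = X p * monomial e' 1 := by
  obtain ⟨p, e', h, rfl⟩ := exists_eq_single_add_of_degree he
  exact ⟨p, e', h, monomial_single_add_one p e'⟩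

theorem monomial_eq_one_of_degree {e : σ →₀ ℕ} (he : e.degree = 0) :
    (monomial e 1 : MvPolynomial σ k) = 1 := by
  rw [(Finsupp.degree_eq_zero_iff e).1 he, monomial_zero', map_one]

theorem exists_monomial_eq_X {e : σ →₀ ℕ} (he : e.degree = 1) :
    ∃ p : σ, (monomial e 1 : MvPolynomial σ k) = X p := by
  obtain ⟨p, e', h, h'⟩ := exists_monomial_eq_X_mul (k := k) he
  exact ⟨p, by rw [h', monomial_eq_one_of_degree h, mul_one]⟩

theorem exists_monomial_eq_X_mul_X {e : σ →₀ ℕ} (he : e.degree = 2) :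
    ∃ p q : σ, (monomial e 1 : MvPolynomial σ k) = X p * X q := by
  obtain ⟨p, e', h, h'⟩ := exists_monomial_eq_X_mul (k := k) he
  obtain ⟨q, hq⟩ := exists_monomial_eq_X (k := k) h
  exact ⟨p, q, by rw [h', hq]⟩

theorem exists_monomial_eq_X_pow_four {e : σ →₀ ℕ} (he : e.degree = 4) :
    ∃ p q r s : σ, (monomial e 1 : MvPolynomial σ k) = X p * X q * (X r * X s) := by
  obtain ⟨p, e', h, h'⟩ := exists_monomial_eq_X_mul (k := k) he
  obtain ⟨q, e'', h2, h2'⟩ := exists_monomial_eq_X_mul (k := k) h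
  obtain ⟨r, s, hrs⟩ := exists_monomial_eq_X_mul_X (k := k) h2
  exact ⟨p, q, r, s, by rw [h', h2', hrs, mul_assoc]⟩

theorem mem_of_forall_monomial_mem (N : Submodule k (MvPolynomial σ k)) {p : MvPolynomial σ k}
    (h : ∀ e ∈ p.support, monomial e (1 : k) ∈ N) : p ∈ N := by
  rw [p.as_sum]
  refine Submodule.sum_mem _ fun e he => ?_
  have : monomial e (coeff e p) = coeff e p • monomial e (1 : k) := by
    rw [smul_monomial, smul_eq_mul, mul_one]
  rw [this]
  exact N.smul_mem _ (h e he)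

theorem mem_of_isHomogeneous (N : Submodule k (MvPolynomial σ k)) {d : ℕ}
    (h : ∀ e : σ →₀ ℕ, e.degree = d → monomial e (1 : k) ∈ N) {p : MvPolynomial σ k}
    (hp : p.IsHomogeneous d) : p ∈ N :=
  mem_of_forall_monomial_mem N fun e he => h e (by
    rw [Finsupp.degree_eq_weight_one]
    exact hp (mem_support_iff.1 he))

/-- The Hilbert function counts a family of forms that spans modulo `I` and has a dual family of
functionals vanishing on `I`. -/
theorem hilbert_eq_card {ι : Type*} [Fintype ι] [DecidableEq ι] (I : Ideal (MvPolynomial σ k))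
    (d : ℕ) (u : ι → MvPolynomial σ k) (φ : ι → MvPolynomial σ k →ₗ[k] k)
    (hu : ∀ i, (u i).IsHomogeneous d) (hφ : ∀ i, ∀ p ∈ I, φ i p = 0)
    (hφu : ∀ i j, φ i (u j) = if i = j then 1 else 0)
    (hspan : ∀ e : σ →₀ ℕ, e.degree = d →
      monomial e (1 : k) ∈ I.restrictScalars k ⊔ Submodule.span k (Set.range u)) :
    hilbert I d = Fintype.card ι := by
  have hM : (homogeneousSubmodule σ k d).map (Ideal.Quotient.mkₐ k I).toLinearMap =
      Submodule.span k (Set.range fun i => Ideal.Quotient.mk I (u i)) := by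
    have hrange : Submodule.span k (Set.range fun i => Ideal.Quotient.mk I (u i)) =
        (Submodule.span k (Set.range u)).map (Ideal.Quotient.mkₐ k I).toLinearMap := by
      rw [Submodule.map_span, ← Set.range_comp]
      rfl
    rw [hrange]
    apply le_antisymm
    · rintro _ ⟨p, hp, rfl⟩
      have hp' := mem_of_isHomogeneous _ hspan ((mem_homogeneousSubmodule d p).1 hp)
      obtain ⟨a, ha, b, hb, rfl⟩ := Submodule.mem_sup.1 hp'
      refine ⟨b, hb, ?_⟩
      have ha' : (Ideal.Quotient.mkₐ k I).toLinearMap a = 0 :=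
        Ideal.Quotient.eq_zero_iff_mem.2 ha
      rw [map_add, ha', zero_add]
    · apply Submodule.map_mono
      rw [Submodule.span_le]
      rintro _ ⟨i, rfl⟩
      exact hu i
  have hli : LinearIndependent k fun i => Ideal.Quotient.mk I (u i) := by
    rw [Fintype.linearIndependent_iff]
    intro g hg j
    have hmem : ∑ i, g i • u i ∈ I := by
      rw [← Ideal.Quotient.eq_zero_iff_mem, ← hg, ← Ideal.Quotient.mkₐ_eq_mk k I, map_sum]
      simp only [map_smul]
    have := hφ j _ hmem
    simpa [map_sum, hφu] using this
  rw [hilbert, hM, finrank_span_eq_card hli]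

theorem hilbert_eq_zero (I : Ideal (MvPolynomial σ k)) (d : ℕ)
    (h : ∀ e : σ →₀ ℕ, e.degree = d → monomial e (1 : k) ∈ I) : hilbert I d = 0 := by
  have := hilbert_eq_card (ι := Empty) I d (fun i => i.elim) (fun i => i.elim) (fun i => i.elim)
    (fun i => i.elim) (fun i => i.elim) (fun e he => Submodule.mem_sup_left (h e he))
  simpa using this

theorem mem_Ann_iff (f : dividedPowers σ k) (s : MvPolynomial σ k) :
    s ∈ Ann f ↔ ∀ t, f.1 (s * t) = 0 := by
  rw [mem_Ann]
  refine ⟨fun h t => by rw [← contract_apply, h]; rfl, fun h => ?_⟩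
  apply Subtype.ext
  apply LinearMap.ext
  intro t
  rw [contract_apply, h]
  rfl

theorem apply_eq_zero_of_mem_Ann {f : dividedPowers σ k} {s : MvPolynomial σ k} (h : s ∈ Ann f) :
    f.1 s = 0 := by
  simpa using (mem_Ann_iff f s).1 h 1

theorem mem_Ann_of_forall_monomial (f : dividedPowers σ k) (s : MvPolynomial σ k)
    (h : ∀ e : σ →₀ ℕ, f.1 (s * monomial e 1) = 0) : s ∈ Ann f := by
  rw [mem_Ann_iff]
  intro t
  exact mem_of_forall_monomial_mem (LinearMap.ker (f.1 ∘ₗ LinearMap.mulLeft k s))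
    (fun e _ => h e)

/-- The functional `s ↦ f (∂s/∂p)` vanishes on the square of the apolar ideal. -/
theorem apply_pderiv_eq_zero (f : dividedPowers σ k) (p : σ) {s : MvPolynomial σ k}
    (h : s ∈ Ann f ^ 2) : f.1 (pderiv p s) = 0 := by
  rw [sq] at h
  refine Submodule.mul_induction_on h (fun a ha b hb => ?_) (fun a b ha hb => ?_)
  · have e1 := (mem_Ann_iff f a).1 ha (pderiv p b)
    have e2 := (mem_Ann_iff f b).1 hb (pderiv p a)
    rw [Derivation.leibniz, smul_eq_mul, smul_eq_mul, map_add, e1, e2, add_zero]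
  · rw [map_add, map_add, ha, hb, add_zero]

theorem dualElement_apply_monomial (p : MvPolynomial σ k) (e : σ →₀ ℕ) :
    (dualElement p).1 (monomial e 1) = coeff e p := by
  classical
  induction p using MvPolynomial.induction_on' with
  | monomial a c =>
    rw [dualElement_monomial]
    change c * coeff a (monomial e (1 : k)) = _
    rw [coeff_monomial, coeff_monomial]
    by_cases h : a = e
    · simp [h]
    · simp [h, Ne.symm h]
  | add p q hp hq =>
    rw [map_add, coeff_add, ← hp, ← hq]
    rfl

theorem X_mul_X_mul_X_eq [DecidableEq σ] (p q r : σ) :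
    (X p * X q * X r : MvPolynomial σ k) = monomial (Multiset.toFinsupp {p, q, r}) 1 := by
  have : ({p, q, r} : Multiset σ) = {p} + ({q} + {r}) := rfl
  rw [this, map_add, map_add, Multiset.toFinsupp_singleton, Multiset.toFinsupp_singleton,
    Multiset.toFinsupp_singleton, monomial_single_add_one, monomial_single_add_one, mul_assoc]
  rfl

theorem triple_eq_triple_iff {α : Type*} (p q r a b c : α) :
    ({p, q, r} : Multiset α) = {a, b, c} ↔
      (p = a ∧ q = b ∧ r = c) ∨ (p = a ∧ q = c ∧ r = b) ∨ (p = b ∧ q = a ∧ r = c) ∨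
      (p = b ∧ q = c ∧ r = a) ∨ (p = c ∧ q = a ∧ r = b) ∨ (p = c ∧ q = b ∧ r = a) := by
  classical
  have hpair : ∀ q r b c : α, (q ::ₘ {r} : Multiset α) = b ::ₘ {c} ↔
      (q = b ∧ r = c) ∨ (q = c ∧ r = b) := by
    intro q r b c
    rw [Multiset.cons_eq_cons]
    simp only [Multiset.singleton_eq_cons_iff, Multiset.singleton_inj]
    grind
  constructor
  · intro h
    have hp : p ∈ ({a, b, c} : Multiset α) := h ▸ Multiset.mem_cons_self _ _
    simp only [Multiset.insert_eq_cons, Multiset.mem_cons, Multiset.mem_singleton] at hp h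
    rcases hp with rfl | rfl | rfl
    · rw [Multiset.cons_inj_right, hpair] at h
      grind
    · rw [Multiset.cons_swap a, Multiset.cons_inj_right, hpair] at h
      grind
    · rw [← Multiset.cons_zero p, Multiset.cons_swap b, Multiset.cons_swap a,
        Multiset.cons_inj_right, Multiset.cons_zero, hpair] at h
      grind
  · simp only [Multiset.insert_eq_cons]
    have s1 : ∀ q r : α, (q ::ₘ {r} : Multiset α) = r ::ₘ {q} := by
      intro q r
      rw [hpair]
      exact Or.inr ⟨rfl, rfl⟩
    rintro (⟨rfl, rfl, rfl⟩ | ⟨rfl, rfl, rfl⟩ | ⟨rfl, rfl, rfl⟩ | ⟨rfl, rfl, rfl⟩ |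
      ⟨rfl, rfl, rfl⟩ | ⟨rfl, rfl, rfl⟩)
    · rfl
    · rw [s1]
    · rw [Multiset.cons_swap]
    · rw [s1 q r, Multiset.cons_swap]
    · rw [Multiset.cons_swap, s1 p r]
    · rw [s1 q p, Multiset.cons_swap, s1 p r, Multiset.cons_swap, s1 q p, Multiset.cons_swap, s1]

end General

/-! ### Monomials of the cubic, and the quotients by I² and J -/

section Cubic

/-- The monomials of the cubic, as multisets of variables. -/
def cubicTerm (m : ℕ) : ZMod m ⊕ (Fin 3 × ZMod m) → Multiset (Fin 3 × ZMod m)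
  | .inl i => {(0, i), (1, i), (2, i)}
  | .inr (x, i) => {(x, i), (x, i + 1), (x, i + 1)}

variable {k : Type*} [Field k] {m : ℕ}

theorem cubic_eq_sum [NeZero m] :
    cubic k m = ∑ g, monomial (Multiset.toFinsupp (cubicTerm m g)) (1 : k) := by
  rw [Fintype.sum_sum_type, Fintype.sum_prod_type, Fin.sum_univ_three]
  simp only [cubicTerm, ← X_mul_X_mul_X_eq, ← Finset.sum_add_distrib, cubic]
  exact Finset.sum_congr rfl fun i _ => by ring

/-- Distinctness of the terms makes every coefficient of F equal to 1, in any characteristic. -/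
theorem cubicTerm_injective (hm : 6 ≤ m) : Function.Injective (cubicTerm m) := by
  obtain ⟨e₀, he₀, n1, n2, n3, n4, n5⟩ := exists_one_mul_ne_zero hm
  have h1 : ∀ i : ZMod m, i + 1 ≠ i := by grind
  have h2 : ∀ i j : ZMod m, i + 1 = j → j + 1 ≠ i := by grind
  clear n1 n2 n3 n4 n5 he₀ e₀
  rintro (i | ⟨x, i⟩) (j | ⟨y, j⟩) h
  all_goals
    rw [cubicTerm, cubicTerm, triple_eq_triple_iff] at h
    simp only [Prod.mk.injEq] at h
  · grind
  · grind
  · grind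
  · grind

theorem cubicDual_monomial [NeZero m] (hm : 6 ≤ m) (s : Multiset (Fin 3 × ZMod m))
    [Decidable (∃ g, cubicTerm m g = s)] :
    (cubicDual k m).1 (monomial (Multiset.toFinsupp s) 1) =
      if ∃ g, cubicTerm m g = s then 1 else 0 := by
  rw [cubicDual, dualElement_apply_monomial, cubic_eq_sum, coeff_sum]
  simp only [coeff_monomial, EmbeddingLike.apply_eq_iff_eq]
  split_ifs with h
  · obtain ⟨g, rfl⟩ := h
    simp [(cubicTerm_injective hm).eq_iff]
  · exact Finset.sum_eq_zero fun g _ => if_neg fun e => h ⟨g, e⟩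

theorem cubicDual_monomial_eq_zero [NeZero m] {e : (Fin 3 × ZMod m) →₀ ℕ} (he : e.degree ≠ 3) :
    (cubicDual k m).1 (monomial e 1) = 0 := by
  rw [cubicDual, dualElement_apply_monomial, cubic_eq_sum, coeff_sum]
  refine Finset.sum_eq_zero fun g _ => ?_
  rw [coeff_monomial, if_neg]
  rintro rfl
  apply he
  rcases g with i | ⟨x, i⟩ <;> rw [cubicTerm] <;>
    simp [Multiset.insert_eq_cons, ← Multiset.singleton_add]

theorem cubicDual_X [NeZero m] (hm : 6 ≤ m) (p q r : Fin 3 × ZMod m)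
    [Decidable (∃ g, cubicTerm m g = {p, q, r})] :
    (cubicDual k m).1 (X p * X q * X r) = if ∃ g, cubicTerm m g = {p, q, r} then 1 else 0 := by
  rw [X_mul_X_mul_X_eq, cubicDual_monomial hm]

theorem cubicTerm_far {x y z : Fin 3} {i j l : ZMod m} (h : Far i j) :
    ¬ ∃ g, cubicTerm m g = {(x, i), (y, j), (z, l)} := by
  rintro ⟨i' | ⟨w, i'⟩, h'⟩ <;> rw [cubicTerm, triple_eq_triple_iff] at h' <;>
    simp only [Prod.mk.injEq] at h' <;> unfold Far at h <;> grind

theorem cubicTerm_mixed (hm : 6 ≤ m) {x y z : Fin 3} {i l : ZMod m} (h : x ≠ y) :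
    ¬ ∃ g, cubicTerm m g = {(x, i), (y, i + 1), (z, l)} := by
  obtain ⟨e₀, he₀, n1, n2, n3, n4, n5⟩ := exists_one_mul_ne_zero hm
  have h1 : ∀ i : ZMod m, i + 1 ≠ i := by grind
  clear n1 n2 n3 n4 n5 he₀ e₀
  rintro ⟨i' | ⟨w, i'⟩, h'⟩ <;> rw [cubicTerm, triple_eq_triple_iff] at h' <;>
    simp only [Prod.mk.injEq] at h' <;> grind

theorem cubicTerm_next (hm : 6 ≤ m) {x z : Fin 3} {i l : ZMod m} :
    (∃ g, cubicTerm m g = {(x, i), (x, i + 1), (z, l)}) ↔ z = x ∧ l = i + 1 := by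
  obtain ⟨e₀, he₀, n1, n2, n3, n4, n5⟩ := exists_one_mul_ne_zero hm
  have h1 : ∀ i : ZMod m, i + 1 ≠ i := by grind
  have h2 : ∀ i j : ZMod m, i + 1 = j → j + 1 ≠ i := by grind
  clear n1 n2 n3 n4 n5 he₀ e₀
  constructor
  · rintro ⟨i' | ⟨w, i'⟩, h'⟩ <;> rw [cubicTerm, triple_eq_triple_iff] at h' <;>
      simp only [Prod.mk.injEq] at h' <;> grind
  · rintro ⟨rfl, rfl⟩
    exact ⟨.inr (z, i), rfl⟩

theorem cubicTerm_square (hm : 6 ≤ m) {x z : Fin 3} {i l : ZMod m} :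
    (∃ g, cubicTerm m g = {(x, i + 1), (x, i + 1), (z, l)}) ↔ z = x ∧ l = i := by
  obtain ⟨e₀, he₀, n1, n2, n3, n4, n5⟩ := exists_one_mul_ne_zero hm
  have h1 : ∀ i : ZMod m, i + 1 ≠ i := by grind
  clear n1 n2 n3 n4 n5 he₀ e₀
  constructor
  · rintro ⟨i' | ⟨w, i'⟩, h'⟩ <;> rw [cubicTerm, triple_eq_triple_iff] at h' <;>
      simp only [Prod.mk.injEq] at h' <;> grind
  · rintro ⟨rfl, rfl⟩
    refine ⟨.inr (z, l), ?_⟩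
    rw [cubicTerm, triple_eq_triple_iff]
    simp

theorem cubicTerm_letters (hm : 6 ≤ m) {x z : Fin 3} {i l : ZMod m} :
    (∃ g, cubicTerm m g = {(x + 1, i), (x + 2, i), (z, l)}) ↔ z = x ∧ l = i := by
  obtain ⟨e₀, he₀, n1, n2, n3, n4, n5⟩ := exists_one_mul_ne_zero hm
  have h1 : ∀ i : ZMod m, i + 1 ≠ i := by grind
  clear n1 n2 n3 n4 n5 he₀ e₀
  constructor
  · rintro ⟨i' | ⟨w, i'⟩, h'⟩ <;> rw [cubicTerm, triple_eq_triple_iff] at h' <;>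
      simp only [Prod.mk.injEq] at h'
    · have hl : l = i := by grind
      have hz : ∀ x z : Fin 3, (z ≠ x + 1 ∧ z ≠ x + 2 → z = x) := by decide
      exact ⟨hz x z (by grind), hl⟩
    · have := QuadricRelations.letter_add_one_ne_add_two x
      grind
  · rintro ⟨rfl, rfl⟩
    refine ⟨.inl l, ?_⟩
    rw [cubicTerm, triple_eq_triple_iff]
    simp only [Prod.mk.injEq, and_true]
    decide +revert

/-- Used with K = J for degree 4 and K = I² for degree 5. -/
theorem quadricRelations_quotient (hm : 6 ≤ m) (K : Ideal (MvPolynomial (Fin 3 × ZMod m) k))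
    (hK : quadricIdeal k m ^ 2 ≤ K) :
    QuadricRelations (fun x i => Ideal.Quotient.mk K (X (x, i)))
      ((quadricIdeal k m).map (Ideal.Quotient.mk K)) where
  far x y i j h := by
    rw [← map_mul]
    exact Ideal.mem_map_of_mem _ (Ideal.subset_span (.far x y i j h.1 h.2.1 h.2.2))
  mixed x y i j h := by
    rw [← map_mul, ← map_mul, ← map_sub]
    exact Ideal.mem_map_of_mem _ (Ideal.subset_span (.mixed x y i j h))
  square x i := by
    rw [← map_mul, ← map_mul, ← map_sub]
    refine Ideal.mem_map_of_mem _ ?_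
    have : IsQuadric k m _ := .square x (x + 1) (x + 2) (i + 1)
      (QuadricRelations.letter_ne_add_one x) (QuadricRelations.letter_ne_add_two x)
      (QuadricRelations.letter_add_one_ne_add_two x)
    rw [add_sub_cancel_right] at this
    have h : _ ∈ quadricIdeal k m := Ideal.subset_span this
    rw [← neg_mem_iff]
    convert h using 1
    ring
  next x i := by
    rw [← map_mul, ← map_mul, ← map_sub]
    refine Ideal.mem_map_of_mem _ ?_
    have : IsQuadric k m _ := .next x (x + 1) (x + 2) (i - 1)
      (QuadricRelations.letter_ne_add_one x) (QuadricRelations.letter_ne_add_two x)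
      (QuadricRelations.letter_add_one_ne_add_two x)
    rw [sub_add_cancel] at this
    have h : _ ∈ quadricIdeal k m := Ideal.subset_span this
    rw [← neg_mem_iff]
    convert h using 1
    ring
  mul_eq_zero p hp q hq := by
    obtain ⟨a, ha, rfl⟩ := (Ideal.mem_map_iff_of_surjective _ Ideal.Quotient.mk_surjective).1 hp
    obtain ⟨b, hb, rfl⟩ := (Ideal.mem_map_iff_of_surjective _ Ideal.Quotient.mk_surjective).1 hq
    rw [← map_mul]
    exact Ideal.Quotient.eq_zero_iff_mem.2 (hK (sq (quadricIdeal k m) ▸ Ideal.mul_mem_mul ha hb))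
  six_le := hm

/-- The quartic monomial `x_i x_{i+1} x_{i+2}^2`. -/
noncomputable def quartic (k : Type*) [Field k] {m : ℕ} (p : Fin 3 × ZMod m) :
    MvPolynomial (Fin 3 × ZMod m) k :=
  X (p.1, p.2) * X (p.1, p.2 + 1) * X (p.1, p.2 + 2) ^ 2

theorem monomial_mem_quarticIdeal (hm : 6 ≤ m) {e : (Fin 3 × ZMod m) →₀ ℕ} (he : e.degree = 4) :
    monomial e (1 : k) ∈ quarticIdeal k m := by
  obtain ⟨⟨x, i⟩, ⟨y, j⟩, ⟨z, l⟩, ⟨w, n⟩, h⟩ := exists_monomial_eq_X_pow_four (k := k) he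
  rw [h, ← Ideal.Quotient.eq_zero_iff_mem]
  simp only [map_mul]
  refine (quadricRelations_quotient hm (quarticIdeal k m) le_sup_left).quartic_eq_zero ?_ _ _ _ _
    _ _ _ _
  intro x i
  rw [← map_mul, ← map_pow, ← map_mul, Ideal.Quotient.eq_zero_iff_mem]
  exact le_sup_right (a := quadricIdeal k m ^ 2) (Ideal.subset_span ⟨x, i, rfl⟩)

theorem X_mul_quartic_mem (hm : 6 ≤ m) (p q : Fin 3 × ZMod m) :
    X p * quartic k q ∈ quadricIdeal k m ^ 2 := by
  rw [← Ideal.Quotient.eq_zero_iff_mem, mul_comm]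
  have := (quadricRelations_quotient (k := k) hm _ le_rfl).quartic_mul_eq_zero q.1 p.1 q.2 p.2
  simpa only [quartic, map_mul, map_pow] using this

theorem X_mul_mem_of_mem_quarticIdeal (hm : 6 ≤ m) (p : Fin 3 × ZMod m)
    {s : MvPolynomial (Fin 3 × ZMod m) k} (hs : s ∈ quarticIdeal k m) :
    X p * s ∈ quadricIdeal k m ^ 2 := by
  obtain ⟨a, ha, b, hb, rfl⟩ := Submodule.mem_sup.1 hs
  rw [mul_add]
  refine add_mem (Ideal.mul_mem_left _ _ ha) ?_
  refine Submodule.span_induction (p := fun b _ => X p * b ∈ quadricIdeal k m ^ 2)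
    (fun b hb => ?_) ?_ (fun _ _ _ _ h h' => ?_) (fun r b _ h => ?_) hb
  · obtain ⟨x, i, rfl⟩ := hb
    exact X_mul_quartic_mem hm p (x, i)
  · rw [mul_zero]
    exact zero_mem _
  · rw [mul_add]
    exact add_mem h h'
  · rw [smul_eq_mul, mul_left_comm]
    exact Ideal.mul_mem_left _ _ h

theorem monomial_mem_quadricIdeal_sq (hm : 6 ≤ m) {e : (Fin 3 × ZMod m) →₀ ℕ}
    (he : e.degree = 5) : monomial e (1 : k) ∈ quadricIdeal k m ^ 2 := by
  obtain ⟨p, e', he', h⟩ := exists_monomial_eq_X_mul (k := k) he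
  rw [h]
  exact X_mul_mem_of_mem_quarticIdeal hm p (monomial_mem_quarticIdeal hm he')

/-- Modulo the square of the ideal of quadrics, the quartic monomials span over `k` the ideal that
they generate. -/
theorem quarticIdeal_le (hm : 6 ≤ m) : (quarticIdeal k m).restrictScalars k ≤
    (quadricIdeal k m ^ 2).restrictScalars k ⊔ Submodule.span k (Set.range (quartic k)) := by
  intro s hs
  obtain ⟨a, ha, b, hb, rfl⟩ := Submodule.mem_sup.1 hs
  refine add_mem (Submodule.mem_sup_left ha) ?_
  refine Submodule.span_induction (fun b hb => ?_) (zero_mem _) (fun _ _ _ _ h h' => add_mem h h')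
    (fun r b hb hb' => ?_) hb
  · obtain ⟨x, i, rfl⟩ := hb
    exact Submodule.mem_sup_right (Submodule.subset_span ⟨(x, i), rfl⟩)
  · have hbJ : b ∈ quarticIdeal k m := le_sup_right (a := quadricIdeal k m ^ 2) hb
    refine mem_of_forall_monomial_mem (Submodule.comap (LinearMap.mulRight k b)
      ((quadricIdeal k m ^ 2).restrictScalars k ⊔ Submodule.span k (Set.range (quartic k))))
      (p := r) fun e _ => ?_
    change monomial e 1 * b ∈
      (quadricIdeal k m ^ 2).restrictScalars k ⊔ Submodule.span k (Set.range (quartic k))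
    -- A nonconstant monomial sends J into I², so only the constant term of `r` contributes to the
    -- span.
    rcases Nat.eq_zero_or_eq_succ_pred e.degree with h0 | h0
    · rwa [monomial_eq_one_of_degree h0, one_mul]
    · obtain ⟨p, e', -, h⟩ := exists_monomial_eq_X_mul (k := k) h0
      rw [h, mul_right_comm]
      exact Submodule.mem_sup_left
        (Ideal.mul_mem_right _ _ (X_mul_mem_of_mem_quarticIdeal hm p hbJ))

end Cubic

/-! ### The apolar ideal of the cubic and its Hilbert functions -/

section Apolar

variable {k : Type*} [Field k] {m : ℕ} [NeZero m]

theorem cubicDual_mul_monomial_eq_zero {q : MvPolynomial (Fin 3 × ZMod m) k} {d : ℕ}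
    (hq : q.IsHomogeneous d) {e : (Fin 3 × ZMod m) →₀ ℕ} (he : d + e.degree ≠ 3) :
    (cubicDual k m).1 (q * monomial e 1) = 0 := by
  refine mem_of_isHomogeneous
    (LinearMap.ker ((cubicDual k m).1 ∘ₗ LinearMap.mulRight k (monomial e 1)))
    (fun e' he' => ?_) hq
  change (cubicDual k m).1 (monomial e' 1 * monomial e 1) = 0
  rw [monomial_mul, one_mul]
  exact cubicDual_monomial_eq_zero (by rwa [map_add, he'])

/-- F lives in degree 3, so a quadric need only be tested against the variables. -/
theorem quadric_mem_Ann {q : MvPolynomial (Fin 3 × ZMod m) k} (hq : q.IsHomogeneous 2)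
    (h : ∀ z l, (cubicDual k m).1 (q * X (z, l)) = 0) : q ∈ Ann (cubicDual k m) := by
  refine mem_Ann_of_forall_monomial _ _ fun e => ?_
  by_cases he : e.degree = 1
  · obtain ⟨⟨z, l⟩, hp⟩ := exists_monomial_eq_X (k := k) he
    rw [hp, h]
  · exact cubicDual_mul_monomial_eq_zero hq (by omega)

theorem isHomogeneous_X_mul_X {σ : Type*} (p q : σ) :
    (X p * X q : MvPolynomial σ k).IsHomogeneous 2 :=
  (isHomogeneous_X k p).mul (isHomogeneous_X k q)

/-- The right-hand side recurs in the next two lemmas: the three quadrics contract F to the same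
dual variable, so their differences annihilate F. -/
theorem cubicDual_letters (hm : 6 ≤ m) (x z : Fin 3) (i l : ZMod m) :
    (cubicDual k m).1 (X (x + 1, i) * X (x + 2, i) * X (z, l)) =
      if z = x ∧ l = i then 1 else 0 := by
  classical
  rw [cubicDual_X hm]
  simp only [cubicTerm_letters hm]

theorem cubicDual_square (hm : 6 ≤ m) (x z : Fin 3) (i l : ZMod m) :
    (cubicDual k m).1 (X (x, i + 1) * X (x, i + 1) * X (z, l)) =
      if z = x ∧ l = i then 1 else 0 := by
  classical
  rw [cubicDual_X hm]
  simp only [cubicTerm_square hm]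

theorem cubicDual_next (hm : 6 ≤ m) (x z : Fin 3) (i l : ZMod m) :
    (cubicDual k m).1 (X (x, i - 1) * X (x, i) * X (z, l)) =
      if z = x ∧ l = i then 1 else 0 := by
  classical
  rw [cubicDual_X hm]
  have := cubicTerm_next hm (x := x) (z := z) (i := i - 1) (l := l)
  rw [sub_add_cancel] at this
  simp only [this]

theorem cubicDual_far (hm : 6 ≤ m) (x y z : Fin 3) {i j : ZMod m} (l : ZMod m) (h : Far i j) :
    (cubicDual k m).1 (X (x, i) * X (y, j) * X (z, l)) = 0 := by
  classical
  rw [cubicDual_X hm, if_neg (cubicTerm_far h)]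

theorem cubicDual_mixed (hm : 6 ≤ m) {x y : Fin 3} (z : Fin 3) (i l : ZMod m) (h : x ≠ y) :
    (cubicDual k m).1 (X (x, i) * X (y, i + 1) * X (z, l)) = 0 := by
  classical
  rw [cubicDual_X hm, if_neg (cubicTerm_mixed hm h)]

theorem far_mem_Ann (hm : 6 ≤ m) (x y : Fin 3) {i j : ZMod m} (h : Far i j) :
    X (x, i) * X (y, j) ∈ Ann (cubicDual k m) :=
  quadric_mem_Ann (isHomogeneous_X_mul_X _ _) fun z l => cubicDual_far hm x y z l h

theorem mixed_mem_Ann (hm : 6 ≤ m) {x y : Fin 3} (i : ZMod m) (h : x ≠ y) :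
    X (x, i) * X (y, i + 1) ∈ Ann (cubicDual k m) :=
  quadric_mem_Ann (isHomogeneous_X_mul_X _ _) fun z l => cubicDual_mixed hm z i l h

theorem letters_sub_square_mem_Ann (hm : 6 ≤ m) (x : Fin 3) (i : ZMod m) :
    X (x + 1, i) * X (x + 2, i) - X (x, i + 1) * X (x, i + 1) ∈ Ann (cubicDual k m) :=
  quadric_mem_Ann ((isHomogeneous_X_mul_X _ _).sub (isHomogeneous_X_mul_X _ _)) fun z l => by
    rw [sub_mul, map_sub, cubicDual_letters hm, cubicDual_square hm, sub_self]

theorem letters_sub_next_mem_Ann (hm : 6 ≤ m) (x : Fin 3) (i : ZMod m) :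
    X (x + 1, i) * X (x + 2, i) - X (x, i - 1) * X (x, i) ∈ Ann (cubicDual k m) :=
  quadric_mem_Ann ((isHomogeneous_X_mul_X _ _).sub (isHomogeneous_X_mul_X _ _)) fun z l => by
    rw [sub_mul, map_sub, cubicDual_letters hm, cubicDual_next hm, sub_self]

theorem third_letter_of_ne (x y z : Fin 3) (hxy : x ≠ y) (hxz : x ≠ z) (hyz : y ≠ z) :
    (y = x + 1 ∧ z = x + 2) ∨ (y = x + 2 ∧ z = x + 1) := by decide +revert

theorem quadricIdeal_le_Ann (hm : 6 ≤ m) : quadricIdeal k m ≤ Ann (cubicDual k m) := by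
  rw [quadricIdeal, Ideal.span_le]
  rintro _ (⟨x, y, i, j, h1, h2, h3⟩ | ⟨x, y, i, j, hxy⟩ | ⟨x, y, z, i, hxy, hxz, hyz⟩ |
    ⟨x, y, z, i, hxy, hxz, hyz⟩)
  · exact far_mem_Ann hm x y ⟨h1, h2, h3⟩
  · exact Ideal.sub_mem _ (mixed_mem_Ann hm i hxy) (mixed_mem_Ann hm j hxy)
  · have := neg_mem (letters_sub_square_mem_Ann (k := k) hm x (i - 1))
    rw [sub_add_cancel] at this
    obtain ⟨rfl, rfl⟩ | ⟨rfl, rfl⟩ := third_letter_of_ne x y z hxy hxz hyz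
    · rw [SetLike.mem_coe]
      convert this using 1
      ring
    · rw [SetLike.mem_coe]
      convert this using 1
      ring
  · have := neg_mem (letters_sub_next_mem_Ann (k := k) hm x (i + 1))
    rw [add_sub_cancel_right] at this
    obtain ⟨rfl, rfl⟩ | ⟨rfl, rfl⟩ := third_letter_of_ne x y z hxy hxz hyz
    · rw [SetLike.mem_coe]
      convert this using 1
      ring
    · rw [SetLike.mem_coe]
      convert this using 1
      ring

theorem card_variables : Fintype.card (Fin 3 × ZMod m) = Nat.card (Fin 3 × ZMod m) :=
  Nat.card_eq_fintype_card.symm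

theorem cubic_cubicDual : cubicDual k m ∈ homogeneousPart (Fin 3 × ZMod m) k 3 := by
  rw [cubicDual, cubic_eq_sum, map_sum]
  refine Submodule.sum_mem _ fun g _ => ?_
  rw [dualElement_monomial, one_smul]
  refine Submodule.subset_span ⟨_, ?_, rfl⟩
  rcases g with i | ⟨x, i⟩ <;> rw [cubicTerm] <;>
    simp [Multiset.insert_eq_cons, ← Multiset.singleton_add]

theorem hilbert_Ann_zero (hm : 6 ≤ m) : hilbert (Ann (cubicDual k m)) 0 = 1 := by
  have hone : (cubicDual k m).1 (X (0 + 1, 0) * X (0 + 2, 0) * X (0, 0)) = 1 := by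
    rw [cubicDual_letters hm, if_pos ⟨rfl, rfl⟩]
  refine hilbert_eq_card (ι := Unit) _ 0 (fun _ => 1)
    (fun _ => (cubicDual k m).1 ∘ₗ LinearMap.mulRight k (X (0 + 1, 0) * X (0 + 2, 0) * X (0, 0)))
    (fun _ => isHomogeneous_one _ _) (fun _ p hp => (mem_Ann_iff _ p).1 hp _) ?_ ?_
  · intro _ _
    rw [if_pos rfl, ← hone]
    simp
  · intro e he
    rw [monomial_eq_one_of_degree he]
    exact Submodule.mem_sup_right (Submodule.subset_span ⟨(), rfl⟩)

theorem hilbert_Ann_one (hm : 6 ≤ m) :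
    hilbert (Ann (cubicDual k m)) 1 = Nat.card (Fin 3 × ZMod m) := by
  rw [← card_variables]
  -- Contracting F by x_{i+1}² leaves the functional dual to x_i.
  refine hilbert_eq_card _ 1 (fun p => X p) (fun p => (cubicDual k m).1 ∘ₗ
    LinearMap.mulRight k (X (p.1, p.2 + 1) * X (p.1, p.2 + 1)))
    (fun p => isHomogeneous_X k p) (fun _ p hp => (mem_Ann_iff _ p).1 hp _) ?_ ?_
  · rintro ⟨x, i⟩ ⟨y, j⟩
    change (cubicDual k m).1 (X (y, j) * (X (x, i + 1) * X (x, i + 1))) = _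
    rw [mul_comm, cubicDual_square hm]
    simp [Prod.ext_iff, eq_comm]
  · intro e he
    obtain ⟨p, hp⟩ := exists_monomial_eq_X (k := k) he
    rw [hp]
    exact Submodule.mem_sup_right (Submodule.subset_span ⟨p, rfl⟩)

theorem hilbert_Ann_two (hm : 6 ≤ m) :
    hilbert (Ann (cubicDual k m)) 2 = Nat.card (Fin 3 × ZMod m) := by
  rw [← card_variables]
  refine hilbert_eq_card _ 2 (fun p => X (p.1 + 1, p.2) * X (p.1 + 2, p.2))
    (fun p => (cubicDual k m).1 ∘ₗ LinearMap.mulRight k (X p))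
    (fun p => isHomogeneous_X_mul_X _ _) (fun _ p hp => (mem_Ann_iff _ p).1 hp _) ?_ ?_
  · rintro ⟨x, i⟩ ⟨y, j⟩
    change (cubicDual k m).1 (X (y + 1, j) * X (y + 2, j) * X (x, i)) = _
    rw [cubicDual_letters hm]
    simp [Prod.ext_iff]
  · intro e he
    obtain ⟨⟨x, i⟩, ⟨y, j⟩, hp⟩ := exists_monomial_eq_X_mul_X (k := k) he
    rw [hp]
    have hletters : ∀ x i, X (x + 1, i) * X (x + 2, i) ∈
        (Ann (cubicDual k m)).restrictScalars k ⊔ Submodule.span k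
        (Set.range fun p : Fin 3 × ZMod m =>
          (X (p.1 + 1, p.2) * X (p.1 + 2, p.2) : MvPolynomial (Fin 3 × ZMod m) k)) :=
      fun x i => Submodule.mem_sup_right (Submodule.subset_span ⟨(x, i), rfl⟩)
    refine QuadricRelations.pair_induction (v := fun x i => X (x, i))
      (C := fun r => r ∈ (Ann (cubicDual k m)).restrictScalars k ⊔ Submodule.span k _)
      (fun x y i j h => Submodule.mem_sup_left (far_mem_Ann hm x y h))
      (fun x y i h => Submodule.mem_sup_left (mixed_mem_Ann hm i h)) hletters
      (fun x i => ?_) (fun x i => ?_) x y i j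
    · have := sub_mem (hletters x i)
        (Submodule.mem_sup_left (letters_sub_square_mem_Ann hm x i))
      rwa [sub_sub_cancel] at this
    · have := sub_mem (hletters x i)
        (Submodule.mem_sup_left (letters_sub_next_mem_Ann hm x i))
      rwa [sub_sub_cancel] at this

theorem hilbert_Ann_three (hm : 6 ≤ m) : hilbert (Ann (cubicDual k m)) 3 = 1 := by
  have hone : (cubicDual k m).1 (X (0 + 1, 0) * X (0 + 2, 0) * X (0, 0)) = 1 := by
    rw [cubicDual_letters hm, if_pos ⟨rfl, rfl⟩]
  have hhom : (X (0 + 1, 0) * X (0 + 2, 0) * X (0, 0) :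
      MvPolynomial (Fin 3 × ZMod m) k).IsHomogeneous 3 :=
    (isHomogeneous_X_mul_X _ _).mul (isHomogeneous_X k _)
  refine hilbert_eq_card (ι := Unit) _ 3 (fun _ => X (0 + 1, 0) * X (0 + 2, 0) * X (0, 0))
    (fun _ => (cubicDual k m).1) (fun _ => hhom)
    (fun _ p hp => apply_eq_zero_of_mem_Ann hp) ?_ ?_
  · intro _ _
    rw [if_pos rfl, hone]
  · intro e he
    set u : MvPolynomial (Fin 3 × ZMod m) k := X (0 + 1, 0) * X (0 + 2, 0) * X (0, 0)
    set c := (cubicDual k m).1 (monomial e 1) with hc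
    have hmem : monomial e (1 : k) - c • u ∈ Ann (cubicDual k m) := by
      refine mem_Ann_of_forall_monomial _ _ fun e' => ?_
      have hh : (monomial e (1 : k) - c • u).IsHomogeneous 3 :=
        (isHomogeneous_monomial _ he).sub
          ((homogeneousSubmodule _ k 3).smul_mem c hhom)
      by_cases he' : e'.degree = 0
      · rw [monomial_eq_one_of_degree he', mul_one, map_sub, map_smul, hone, ← hc]
        simp
      · exact cubicDual_mul_monomial_eq_zero hh (by omega)
    rw [← sub_add_cancel (monomial e (1 : k)) (c • u)]
    exact Submodule.add_mem_sup hmem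
      (Submodule.smul_mem _ c (Submodule.subset_span ⟨(), rfl⟩))

theorem hilbert_Ann_of_four_le {d : ℕ} (hd : 4 ≤ d) : hilbert (Ann (cubicDual k m)) d = 0 := by
  refine hilbert_eq_zero _ d fun e he => mem_Ann_of_forall_monomial _ _ fun e' => ?_
  rw [monomial_mul, one_mul]
  exact cubicDual_monomial_eq_zero (by rw [map_add]; omega)

/-- Only the derivative in x_j gives a monomial of F, namely x_{j+1} x_{j+2}². The derivatives in
x_{j+1} and x_{j+2} retain the far pair x_j x_{j+2}, so the factor 2 is harmless in every
characteristic. -/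
theorem cubicDual_pderiv_quartic (hm : 6 ≤ m) (p q : Fin 3 × ZMod m) :
    (cubicDual k m).1 (pderiv p (quartic k q)) = if p = q then 1 else 0 := by
  obtain ⟨x, i⟩ := p
  obtain ⟨y, j⟩ := q
  have hfar : Far j (j + 2) := by
    obtain ⟨e₀, he₀, n1, n2, n3, n4, n5⟩ := exists_one_mul_ne_zero hm
    unfold Far
    grind
  have e1 := cubicDual_square (k := k) hm y y (j + 1) (j + 1)
  have e2 := cubicDual_far (k := k) hm y y y (j + 2) hfar
  have e3 := cubicDual_far (k := k) hm y y y (j + 1) hfar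
  rw [add_assoc, one_add_one_eq_two, if_pos ⟨rfl, rfl⟩] at e1
  have expand : pderiv (x, i) (quartic k (y, j)) =
      (Pi.single (M := fun _ => k) (x, i) 1 (y, j)) •
        (X (y, j + 2) * X (y, j + 2) * X (y, j + 1)) +
      (Pi.single (M := fun _ => k) (x, i) 1 (y, j + 1)) •
        (X (y, j) * X (y, j + 2) * X (y, j + 2)) +
      (2 * Pi.single (M := fun _ => k) (x, i) 1 (y, j + 2)) •
        (X (y, j) * X (y, j + 2) * X (y, j + 1)) := by
    have hX : ∀ q : Fin 3 × ZMod m, pderiv (x, i) (X q : MvPolynomial (Fin 3 × ZMod m) k) =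
        C (Pi.single (M := fun _ => k) (x, i) 1 q) := by
      intro q
      rw [pderiv_X, Pi.single_apply, Pi.single_apply]
      split_ifs <;> simp
    simp only [quartic, Derivation.leibniz, Derivation.leibniz_pow, hX, smul_eq_C_mul,
      smul_eq_mul, nsmul_eq_mul, map_mul, map_ofNat]
    push_cast
    ring
  rw [expand]
  simp only [map_add, map_smul, e1, e2, e3, smul_eq_mul, mul_one, mul_zero, add_zero,
    Pi.single_apply, eq_comm]

theorem hilbert_Ann_sq_four (hm : 6 ≤ m) :
    hilbert (Ann (cubicDual k m) ^ 2) 4 = Nat.card (Fin 3 × ZMod m) := by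
  rw [← card_variables]
  refine hilbert_eq_card _ 4 (quartic k) (fun p => (cubicDual k m).1 ∘ₗ (pderiv p).toLinearMap)
    (fun p => ?_) (fun p s hs => apply_pderiv_eq_zero _ p hs)
    (fun p q => cubicDual_pderiv_quartic hm p q) (fun e he => ?_)
  · exact (isHomogeneous_X_mul_X _ _).mul ((isHomogeneous_X k _).pow 2)
  · have hle : (quadricIdeal k m ^ 2).restrictScalars k ≤
        (Ann (cubicDual k m) ^ 2).restrictScalars k :=
      fun _ hs => Ideal.pow_right_mono (quadricIdeal_le_Ann hm) 2 hs
    have hle' := sup_le_sup_right hle (Submodule.span k (Set.range (quartic k)))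
    exact hle' (quarticIdeal_le hm (monomial_mem_quarticIdeal hm he))

theorem hilbert_Ann_sq_five (hm : 6 ≤ m) : hilbert (Ann (cubicDual k m) ^ 2) 5 = 0 :=
  hilbert_eq_zero _ 5 fun _ he =>
    Ideal.pow_right_mono (quadricIdeal_le_Ann hm) 2 (monomial_mem_quadricIdeal_sq hm he)

end Apolar

end ApolarCubic

open ApolarCubic

theorem mainTheorem4 (k : Type*) [Field k] (m : ℕ) [NeZero m] (hm : 6 ≤ m) :
    ApolarCubic.SmallTangentSpace (ApolarCubic.cubicDual k m) ∧
    ApolarCubic.quadricIdeal k m ≤ ApolarCubic.Ann (ApolarCubic.cubicDual k m) ∧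
    (∀ p : MvPolynomial (Fin 3 × ZMod m) k, p.IsHomogeneous 4 →
      p ∈ ApolarCubic.quarticIdeal k m) ∧
    (∀ e : (Fin 3 × ZMod m) →₀ ℕ, e.degree = 5 →
      MvPolynomial.monomial e (1 : k) ∈ ApolarCubic.quadricIdeal k m ^ 2) := by
  refine ⟨⟨cubic_cubicDual, hilbert_Ann_zero hm, hilbert_Ann_one hm, hilbert_Ann_two hm,
    hilbert_Ann_three hm, fun d hd => hilbert_Ann_of_four_le hd, hilbert_Ann_sq_four hm,
    hilbert_Ann_sq_five hm⟩, quadricIdeal_le_Ann hm, fun p hp => ?_,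
    fun e he => monomial_mem_quadricIdeal_sq hm he⟩
  exact mem_of_isHomogeneous ((quarticIdeal k m).restrictScalars k)
    (fun e he => monomial_mem_quarticIdeal hm he) hp
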